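/- Let $n,k\ge 1$ be integers and let $\mathcal G$ be a partition of the set of agents $N=\{1,\dots,n\}$ into nonempty groups; write $G_i\in\mathcal G$ for the group containing agent $i$. A feasible allocation of $k$ identical tickets is a vector $x\in\{0,1,\dots,k\}^n$ with $\sum_{i} x_i\le k$, and a lottery allocation is a probability distribution $\pi$ over feasible allocations. The utility of agent $i$ is $u_i(x)=1$ if $\sum_{j\in G_i}x_j\ge |G_i|$ and $u_i(x)=0$ otherwise, and $u_i(\pi)=\sum_x \pi_x u_i(x)$. A lottery allocation $\pi$ is $\beta$-efficient if $\frac1k\sum_{i\in N}u_i(\pi)\ge\beta$, and $\beta$-fair if $u_i(\pi)\ge\beta\,u_{i'}(\pi)$ for all $i,i'\in N$. In the Weighted Individual Lottery each agent $i$ requests a number $a_i\in\{1,\dots,k\}$ of tickets. A random order $\Sigma$ of the agents is generated by drawing agents sequentially without replacement with probability inversely proportional to their request, that is, for every order $\sigma=(\sigma_1,\dots,\sigma_n)$ of $N$, $$\mathbb P(\Sigma=\sigma)=\prod_{t=1}^{n}\frac{1/a_{\sigma_t}}{\sum_{i\in N\setminus\{\sigma_1,\dots,\sigma_{t-1}\}}1/a_i}.$$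 The agents are processed in this order, and each agent receives the minimum of its request and the number of remaining tickets: $$x_{\sigma_t}=\min\Bigl\{a_{\sigma_t},\ \max\Bigl\{k-\sum_{s<t}a_{\sigma_s},\,0\Bigr\}\Bigr\}.$$ The group request outcome is the resulting lottery allocation when every agent $i$ requests $a_i=|G_i|$ tickets. For $\kappa,\alpha\in(0,1)$ let $I(\kappa,\alpha)$ be the family of all instances $(n,k,\mathcal G)$ with $$\frac{\max_{G\in\mathcal G}|G|-1}{k}\le\kappa\quad\text{and}\quad\frac kn\le\alpha$$ (so that $|G|\le k$ for every $G\in\mathcal G$ and the group requests are admissible), and let $g(x)=(1-e^{-x})/x$ for $x>0$. **Theorem.** Fix $\kappa,\alpha\in(0,1)$. For every instance in $I(\kappa,\alpha)$, the group request outcome of the Weighted Individual Lottery is $(1-\kappa)g(\alpha)$-efficient and $(1-2\kappa)g(\alpha)$-fair. -/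

import Mathlib

namespace TicketLottery

noncomputable section

/-! ### Feasible allocations and lottery allocations -/

/-- Feasible allocations of `k` identical tickets to `n` agents: `x i ∈ {0, …, k}` is the number of
tickets of agent `i`, and at most `k` tickets are handed out in total. -/
abbrev Allocation (n k : ℕ) : Type :=
  {x : Fin n → Fin (k + 1) // ∑ i, (x i : ℕ) ≤ k}

/-- Lottery allocations: probability distributions over the feasible allocations. -/
abbrev LotteryAllocation (n k : ℕ) : Type :=
  stdSimplex ℝ (Allocation n k)

/-! ### Instances, utilities, efficiency and fairness -/

/-- An instance: `n ≥ 1` agents, `k ≥ 1` tickets and a partition of the agents into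
(nonempty) groups. -/
structure LotteryInstance where
  n : ℕ
  k : ℕ
  n_pos : 0 < n
  k_pos : 0 < k
  groups : Finpartition (Finset.univ : Finset (Fin n))

namespace LotteryInstance

variable (I : LotteryInstance)

/-- The group `G_i` that contains agent `i`. -/
def group (i : Fin I.n) : Finset (Fin I.n) := I.groups.part i

/-- The maximum size of a group. -/
def maxGroupSize : ℕ := I.groups.parts.sup Finset.card

/-- The utility `u_i(x) ∈ {0, 1}`: agent `i` is successful iff the members of its group together
receive at least as many tickets as the group has members. -/
def utility (i : Fin I.n) (x : Allocation I.n I.k) : ℝ :=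
  if (I.group i).card ≤ ∑ j ∈ I.group i, (x.1 j : ℕ) then 1 else 0

/-- The expected utility `u_i(π)` of agent `i` under a lottery allocation `π`. -/
def expectedUtility (i : Fin I.n) (π : LotteryAllocation I.n I.k) : ℝ :=
  ∑ x, π.1 x * I.utility i x

/-- The expected utilization `U(π) = (1/k) ∑ i, u_i(π)`. -/
def utilization (π : LotteryAllocation I.n I.k) : ℝ :=
  1 / (I.k : ℝ) * ∑ i, I.expectedUtility i π

/-- `β`-efficiency: `U(π) ≥ β`. -/
def IsEfficient (β : ℝ) (π : LotteryAllocation I.n I.k) : Prop :=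
  β ≤ I.utilization π

/-- `β`-fairness: `u_i(π) ≥ β u_{i'}(π)` for all agents `i`, `i'`. -/
def IsFair (β : ℝ) (π : LotteryAllocation I.n I.k) : Prop :=
  ∀ i i' : Fin I.n, β * I.expectedUtility i' π ≤ I.expectedUtility i π

end LotteryInstance

/-- The family `I(κ, α)`: `(max_G |G| - 1) / k ≤ κ` and `k / n ≤ α`. -/
def instanceFamily (κ α : ℝ) : Set LotteryInstance :=
  {I | ((I.maxGroupSize : ℝ) - 1) / I.k ≤ κ ∧ (I.k : ℝ) / I.n ≤ α}

/-! ### The Weighted Individual Lottery -/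

/-- The action set `{1, …, k}`: the number of tickets that an agent requests. -/
abbrev Request (k : ℕ) : Type := {a : ℕ // 1 ≤ a ∧ a ≤ k}

/-- An order `σ` over the agents maps each position `t` to the agent `σ t`. This is the set of the
agents in the positions strictly before `t`. -/
def before {n : ℕ} (σ : Equiv.Perm (Fin n)) (t : Fin n) : Finset (Fin n) :=
  (Finset.Iio t).image σ

/-- The number of tickets that agent `i` receives when the agents are processed in the order `σ`:
the minimum of its request and the number of tickets that remain. The subtraction is truncated at
zero. -/
def ticketsOf {n k : ℕ} (a : Fin n → Request k) (σ : Equiv.Perm (Fin n)) (i : Fin n) : ℕ :=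
  min (a i : ℕ) (k - ∑ j ∈ before σ (σ.symm i), (a j : ℕ))

theorem sum_min_sub (k : ℕ) : ∀ (n : ℕ) (f : Fin n → ℕ),
    ∑ t, min (f t) (k - ∑ s ∈ Finset.Iio t, f s) = min k (∑ t, f t) := by
  intro n
  induction n with
  | zero => intro f; simp
  | succ n ih =>
    intro f
    have h1 : ∀ t : Fin n, ∑ s ∈ Finset.Iio t.castSucc, f s
        = ∑ s ∈ Finset.Iio t, f s.castSucc := by
      intro t
      rw [← Fin.map_castSuccEmb_Iio, Finset.sum_map]
      rfl
    have h2 : ∑ s ∈ Finset.Iio (Fin.last n), f s = ∑ s : Fin n, f s.castSucc := by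
      rw [Fin.Iio_last_eq_map, Finset.sum_map]
      rfl
    rw [Fin.sum_univ_castSucc, Fin.sum_univ_castSucc, h2]
    simp only [h1]
    rw [ih (fun t => f t.castSucc)]
    omega

theorem sum_ticketsOf_le {n k : ℕ} (a : Fin n → Request k) (σ : Equiv.Perm (Fin n)) :
    ∑ i, ticketsOf a σ i ≤ k := by
  have h : ∑ i, ticketsOf a σ i
      = ∑ t, min (a (σ t) : ℕ) (k - ∑ s ∈ Finset.Iio t, (a (σ s) : ℕ)) := by
    rw [← Equiv.sum_comp σ]
    refine Finset.sum_congr rfl fun t _ => ?_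
    simp [ticketsOf, before, Finset.sum_image σ.injective.injOn]
  rw [h, sum_min_sub k n (fun t => (a (σ t) : ℕ))]
  exact min_le_left _ _

/-- The feasible allocation that results from processing the agents in the order `σ`. -/
def allocate {n k : ℕ} (a : Fin n → Request k) (σ : Equiv.Perm (Fin n)) : Allocation n k :=
  ⟨fun i => ⟨ticketsOf a σ i, Nat.lt_succ_of_le
      ((Finset.single_le_sum (f := ticketsOf a σ) (fun _ _ => Nat.zero_le _)
        (Finset.mem_univ i)).trans (sum_ticketsOf_le a σ))⟩,
    sum_ticketsOf_le a σ⟩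

/-- The probability of the order `σ` when agents are drawn sequentially without replacement, each
time with probability proportional to the weights `w` of the agents that are left. -/
def drawProb {n : ℕ} (w : Fin n → ℝ) (σ : Equiv.Perm (Fin n)) : ℝ :=
  ∏ t, w (σ t) / ∑ i ∈ Finset.univ \ before σ t, w i

theorem sum_compl_before {n : ℕ} (w : Fin n → ℝ) (σ : Equiv.Perm (Fin n)) (t : Fin n) :
    ∑ i ∈ Finset.univ \ before σ t, w i = ∑ s ∈ Finset.Ici t, w (σ s) := by
  rw [← Finset.sum_image (f := w) (g := σ) σ.injective.injOn]
  congr 1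
  ext i
  simp only [before, Finset.mem_sdiff, Finset.mem_univ, true_and, Finset.mem_image,
    Finset.mem_Iio, Finset.mem_Ici]
  constructor
  · intro h
    exact ⟨σ.symm i, not_lt.1 fun hl => h ⟨_, hl, by simp⟩, by simp⟩
  · rintro ⟨s, hs, rfl⟩ ⟨r, hr, hrs⟩
    rw [σ.injective hrs] at hr
    exact absurd hr (not_lt.2 hs)

theorem sum_drawProb : ∀ (n : ℕ) (w : Fin n → ℝ), (∀ i, 0 < w i) →
    ∑ σ : Equiv.Perm (Fin n), drawProb w σ = 1 := by
  intro n
  induction n with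
  | zero => intro w _; simp [drawProb]
  | succ n ih =>
    intro w hw
    have hpos : 0 < ∑ i, w i :=
      Finset.sum_pos (fun i _ => hw i) Finset.univ_nonempty
    have key : ∀ (p : Fin (n + 1)) (e : Equiv.Perm (Fin n)),
        drawProb w (Equiv.Perm.decomposeFin.symm (p, e))
          = w p / (∑ i, w i) * drawProb (fun j => w (Equiv.swap 0 p j.succ)) e := by
      intro p e
      simp only [drawProb, sum_compl_before]
      rw [Fin.prod_univ_succ]
      congr 1
      · rw [Equiv.Perm.decomposeFin_symm_apply_zero]
        congr 1
        have : (Finset.Ici (0 : Fin (n + 1))) = Finset.univ := by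
          ext i; simp
        rw [this, Equiv.sum_comp (Equiv.Perm.decomposeFin.symm (p, e)) w]
      · refine Finset.prod_congr rfl fun t _ => ?_
        rw [Equiv.Perm.decomposeFin_symm_apply_succ]
        congr 1
        rw [← Fin.map_succEmb_Ici, Finset.sum_map]
        refine Finset.sum_congr rfl fun s _ => ?_
        simp [Equiv.Perm.decomposeFin_symm_apply_succ]
    rw [← Equiv.sum_comp Equiv.Perm.decomposeFin.symm, Fintype.sum_prod_type]
    simp only [key]
    simp only [← Finset.mul_sum]
    have h1 : ∀ p : Fin (n + 1), ∑ e : Equiv.Perm (Fin n),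
        drawProb (fun j => w (Equiv.swap 0 p j.succ)) e = 1 :=
      fun p => ih _ fun _ => hw _
    simp only [h1, mul_one]
    rw [← Finset.sum_div, div_self hpos.ne']

/-- The law of the random order of the Weighted Individual Lottery: agents are drawn sequentially
without replacement, with probability inversely proportional to their request. -/
def orderProb {n k : ℕ} (a : Fin n → Request k) (σ : Equiv.Perm (Fin n)) : ℝ :=
  drawProb (fun i => 1 / ((a i : ℕ) : ℝ)) σ

/-- The Weighted Individual Lottery: the allocation `x` has the probability of the set of the orders
that lead to `x`. -/
def weightedIndividualLottery {n k : ℕ} (a : Fin n → Request k) : LotteryAllocation n k :=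
  ⟨fun x => ∑ σ : Equiv.Perm (Fin n), if x = allocate a σ then orderProb a σ else 0, by
    have hw : ∀ i, (0 : ℝ) < 1 / ((a i : ℕ) : ℝ) := fun i => by
      have : 0 < (a i : ℕ) := (a i).2.1
      positivity
    constructor
    · intro x
      refine Finset.sum_nonneg fun σ _ => ?_
      split_ifs
      · unfold orderProb drawProb
        exact Finset.prod_nonneg fun t _ =>
          div_nonneg (hw (σ t)).le (Finset.sum_nonneg fun i _ => (hw i).le)
      · exact le_rfl
    · rw [Finset.sum_comm]
      simp only [Finset.sum_ite_eq', Finset.mem_univ, if_true]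
      exact sum_drawProb n _ hw⟩

/-! ### The group request strategy -/

/-- The group request profile: each agent `i` requests `|G_i|` tickets. This is a profile of
admissible actions when no group has more than `k` members. -/
def LotteryInstance.groupRequest (I : LotteryInstance) (h : I.maxGroupSize ≤ I.k) :
    Fin I.n → Request I.k := fun i =>
  ⟨(I.group i).card,
    Finset.card_pos.2 ⟨i, I.groups.mem_part (Finset.mem_univ i)⟩,
    (Finset.le_sup (f := Finset.card) (I.groups.part_mem.2 (Finset.mem_univ i))).trans h⟩

theorem maxGroupSize_le {κ α : ℝ} (hκ : κ < 1) {I : LotteryInstance}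
    (hI : I ∈ instanceFamily κ α) : I.maxGroupSize ≤ I.k := by
  have hk : (0 : ℝ) < I.k := by exact_mod_cast I.k_pos
  have h1 : ((I.maxGroupSize : ℝ) - 1) / I.k < 1 := lt_of_le_of_lt hI.1 hκ
  rw [div_lt_one hk] at h1
  have h2 : (I.maxGroupSize : ℝ) < (I.k : ℝ) + 1 := by linarith
  have h3 : I.maxGroupSize < I.k + 1 := by exact_mod_cast h2
  omega

/-- The function `g(x) = (1 - e^{-x}) / x`, for `x > 0`. -/
def g (x : ℝ) : ℝ := (1 - Real.exp (-x)) / x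

end

end TicketLottery

/-!
The group `G` of an agent fails exactly when the agents drawn before its first member request more
than `k - |G|` tickets in total. With weights `1 / |G_i|` every group has total weight `1`, and
after each draw the procedure restarts among the remaining agents with the remaining budget `K`, so
the failure probability can be compared with functions of `K` that are super- or submartingales
until `K` becomes negative or a member of `G` is drawn. Let `m` be the maximum group size.

For the lower bound on the utility, `exp (-θ (K + 1))` is a supermartingale as soon as
`∑ (exp (θ |G_j|) - 1) / |G_j| ≤ 1`, the sum being over the agents outside `G`. As
`exp x ≤ 1 / (1 - x)`, the choice `θ = 1 / (n - |G| + m)` is admissible, and `G` fails with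
probability at most `exp (-(k - |G| + 1) / (n - |G| + m)) ≤ exp (-(k - m + 1) / n)`.

For the upper bound, `c / (c + K + m)` is a submartingale, because the agents outside `G` that are
left always number at least `c + K + m - 1` for `c = n + 1 - k - m`. Hence `G` succeeds with
probability at most `(k + m - 1) / n`.

In `I(κ, α)` these bounds give `(1 - κ) g(α) k / n ≤ u_i ≤ (1 + κ) k / n`, using that
`1 - exp (-x)` is concave. The lower bound is efficiency, and fairness follows from
`(1 - 2κ) (1 + κ) ≤ 1 - κ`.
-/

namespace TicketLottery

open Finset

/-! ### The first draw -/

section FirstDraw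

variable {n : ℕ}

theorem mem_before {σ : Equiv.Perm (Fin n)} {t i : Fin n} : i ∈ before σ t ↔ σ.symm i < t := by
  simp only [before, mem_image, mem_Iio]
  exact ⟨fun ⟨s, hs, h⟩ => by simpa [← h] using hs, fun h => ⟨_, h, σ.apply_symm_apply i⟩⟩

/-- The labelling by `Fin n` of the agents other than `p`, used for the draws that follow a first
draw of `p`. It is the labelling built into `Equiv.Perm.decomposeFin`: agent `0` takes the place of
`p`. -/
def relabel (p : Fin (n + 1)) : Fin n ↪ Fin (n + 1) :=
  (Fin.succEmb n).trans (Equiv.swap 0 p).toEmbedding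

/-- The members of `G` that are left once `p` has been drawn, in the labelling `relabel p`. -/
def survivors (p : Fin (n + 1)) (G : Finset (Fin (n + 1))) : Finset (Fin n) :=
  {j | relabel p j ∈ G}

theorem mem_survivors {p : Fin (n + 1)} {G : Finset (Fin (n + 1))} {j : Fin n} :
    j ∈ survivors p G ↔ relabel p j ∈ G := by
  simp only [survivors, mem_filter, mem_univ, true_and]

theorem compl_survivors (p : Fin (n + 1)) (G : Finset (Fin (n + 1))) :
    (survivors p G)ᶜ = survivors p Gᶜ := by
  ext j
  simp only [mem_compl, mem_survivors]

theorem map_relabel_univ (p : Fin (n + 1)) : univ.map (relabel p) = {p}ᶜ := by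
  have hsucc : univ.map (Fin.succEmb n) = {0}ᶜ := by simp [map_eq_image]
  rw [relabel, ← map_map, hsucc]
  ext i
  simp [mem_map_equiv, Equiv.swap_apply_eq_iff]

theorem map_relabel_survivors (p : Fin (n + 1)) (G : Finset (Fin (n + 1))) :
    (survivors p G).map (relabel p) = G.erase p := by
  ext i
  have hi : (∃ j, relabel p j = i) ↔ i ≠ p := by
    simpa using congrArg (i ∈ ·) (map_relabel_univ p)
  simp only [mem_map, mem_survivors, mem_erase, ← hi]
  aesop

theorem sum_survivors {M : Type*} [AddCommMonoid M] (p : Fin (n + 1)) (G : Finset (Fin (n + 1)))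
    (f : Fin (n + 1) → M) : ∑ j ∈ survivors p G, f (relabel p j) = ∑ i ∈ G.erase p, f i := by
  rw [← map_relabel_survivors, sum_map]

theorem decomposeFin_symm_succ (p : Fin (n + 1)) (e : Equiv.Perm (Fin n)) (t : Fin n) :
    Equiv.Perm.decomposeFin.symm (p, e) t.succ = relabel p (e t) :=
  Equiv.Perm.decomposeFin_symm_apply_succ e p t

theorem before_zero (σ : Equiv.Perm (Fin (n + 1))) : before σ 0 = ∅ := by
  ext i
  simp [mem_before]

theorem before_decomposeFin_succ (p : Fin (n + 1)) (e : Equiv.Perm (Fin n)) (t : Fin n) :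
    before (Equiv.Perm.decomposeFin.symm (p, e)) t.succ
      = insert p ((before e t).map (relabel p)) := by
  have hIio : Iio t.succ = insert 0 ((Iio t).map (Fin.succEmb n)) := by
    ext i
    cases i using Fin.cases <;> simp
  rw [before, hIio, image_insert, Equiv.Perm.decomposeFin_symm_apply_zero, map_eq_image,
    image_image, before, map_eq_image, image_image]
  exact congrArg _ (image_congr fun s _ => decomposeFin_symm_succ p e s)

theorem drawProb_decomposeFin (w : Fin (n + 1) → ℝ) (p : Fin (n + 1)) (e : Equiv.Perm (Fin n)) :
    drawProb w (Equiv.Perm.decomposeFin.symm (p, e))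
      = w p / (∑ i, w i) * drawProb (fun j => w (relabel p j)) e := by
  have hleft (t : Fin n) : univ \ before (Equiv.Perm.decomposeFin.symm (p, e)) t.succ
      = (univ \ before e t).map (relabel p) := by
    rw [Finset.map_sdiff, map_relabel_univ, before_decomposeFin_succ, insert_eq,
      compl_eq_univ_sdiff, sdiff_sdiff_left, sup_eq_union]
  rw [drawProb, Fin.prod_univ_succ, before_zero, sdiff_empty,
    Equiv.Perm.decomposeFin_symm_apply_zero]
  simp only [hleft, sum_map, decomposeFin_symm_succ, drawProb]

theorem drawProb_nonneg {w : Fin n → ℝ} (hw : ∀ i, 0 ≤ w i) (σ : Equiv.Perm (Fin n)) :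
    0 ≤ drawProb w σ :=
  prod_nonneg fun t _ => div_nonneg (hw (σ t)) (sum_nonneg fun i _ => hw i)

end FirstDraw

/-! ### The probability that a group misses the budget -/

section MissProb

variable {n : ℕ}

/-- In the order `σ`, the agents before any member of `G` request more than `K` tickets together,
so that no member of `G` is served within the budget `K`. The budget is an integer because it
drops below zero when a request overshoots it. -/
abbrev Misses (a : Fin n → ℕ) (G : Finset (Fin n)) (K : ℤ) (σ : Equiv.Perm (Fin n)) : Prop :=
  ∀ t, σ t ∈ G → K < (∑ i ∈ before σ t, a i : ℕ)

/-- The probability of `Misses a G K` when the agents are drawn with weights `w`. -/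
noncomputable def missProb (w : Fin n → ℝ) (a : Fin n → ℕ) (G : Finset (Fin n)) (K : ℤ) : ℝ :=
  ∑ σ with Misses a G K σ, drawProb w σ

theorem missProb_nonneg {w : Fin n → ℝ} (hw : ∀ i, 0 ≤ w i) (a : Fin n → ℕ)
    (G : Finset (Fin n)) (K : ℤ) : 0 ≤ missProb w a G K :=
  sum_nonneg fun σ _ => drawProb_nonneg hw σ

theorem missProb_eq_one {w : Fin n → ℝ} (hw : ∀ i, 0 < w i) {a : Fin n → ℕ}
    {G : Finset (Fin n)} {K : ℤ} (h : ∀ σ, Misses a G K σ) : missProb w a G K = 1 := by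
  rw [missProb, filter_true_of_mem fun σ _ => h σ, sum_drawProb n w hw]

theorem missProb_of_neg {w : Fin n → ℝ} (hw : ∀ i, 0 < w i) (a : Fin n → ℕ)
    (G : Finset (Fin n)) {K : ℤ} (hK : K < 0) : missProb w a G K = 1 :=
  missProb_eq_one hw fun _ _ _ => hK.trans_le (Nat.cast_nonneg _)

theorem misses_decomposeFin (a : Fin (n + 1) → ℕ) (G : Finset (Fin (n + 1))) {K : ℤ}
    (hK : 0 ≤ K) (p : Fin (n + 1)) (e : Equiv.Perm (Fin n)) :
    Misses a G K (Equiv.Perm.decomposeFin.symm (p, e)) ↔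
      p ∉ G ∧ Misses (fun j => a (relabel p j)) (survivors p G) (K - a p) e := by
  have hp (B : Finset (Fin n)) : p ∉ B.map (relabel p) := fun h => by
    simpa [map_relabel_univ] using map_subset_map.2 (subset_univ B) h
  simp only [Misses, Fin.forall_fin_succ, Equiv.Perm.decomposeFin_symm_apply_zero, before_zero,
    sum_empty, Nat.cast_zero, hK.not_gt, imp_false, decomposeFin_symm_succ,
    before_decomposeFin_succ, sum_insert (hp _), sum_map, mem_survivors, Nat.cast_add,
    sub_lt_iff_lt_add']

/-- The conditional probability of `Misses a G K` given that the agent `p`, not a member of `G`, is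
drawn first: the draw starts afresh among the other agents, with what `p` leaves of the budget. -/
noncomputable def missProbAfter (p : Fin (n + 1)) (w : Fin (n + 1) → ℝ) (a : Fin (n + 1) → ℕ)
    (G : Finset (Fin (n + 1))) (K : ℤ) : ℝ :=
  missProb (fun j => w (relabel p j)) (fun j => a (relabel p j)) (survivors p G) (K - a p)

theorem missProb_mul_sum {w : Fin (n + 1) → ℝ} (hw : ∑ i, w i ≠ 0) (a : Fin (n + 1) → ℕ)
    (G : Finset (Fin (n + 1))) {K : ℤ} (hK : 0 ≤ K) :
    missProb w a G K * ∑ i, w i = ∑ p ∈ Gᶜ, w p * missProbAfter p w a G K := by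
  rw [missProb, sum_filter, ← Equiv.sum_comp Equiv.Perm.decomposeFin.symm, Fintype.sum_prod_type,
    sum_mul, ← univ_inter Gᶜ, ← sum_ite_mem]
  refine sum_congr rfl fun p _ => ?_
  by_cases hp : p ∈ G
  · simp only [misses_decomposeFin a G hK, mem_compl, hp, not_true, false_and, if_false,
      sum_const_zero, zero_mul]
  · simp only [misses_decomposeFin a G hK, mem_compl, hp, not_false_eq_true, true_and, if_true,
      drawProb_decomposeFin, ← sum_filter, ← mul_sum]
    rw [mul_right_comm, div_mul_cancel₀ _ hw, missProbAfter, missProb]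

/-! ### Bounds from super- and submartingales in the remaining budget -/

theorem missProb_le_of_missProbAfter_le {w : Fin (n + 1) → ℝ} (hw : ∀ i, 0 < w i)
    {a : Fin (n + 1) → ℕ} {G : Finset (Fin (n + 1))} {K : ℤ} (hK : 0 ≤ K)
    {B : ℝ} {F : Fin (n + 1) → ℝ} (hF : ∀ p ∈ Gᶜ, missProbAfter p w a G K ≤ F p)
    (hB : ∑ p ∈ Gᶜ, w p * F p ≤ B * (∑ p ∈ G, w p + ∑ p ∈ Gᶜ, w p)) :
    missProb w a G K ≤ B := by
  have hW : 0 < ∑ i, w i := sum_pos (fun i _ => hw i) univ_nonempty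
  rw [sum_add_sum_compl] at hB
  refine le_of_mul_le_mul_right (le_trans ?_ hB) hW
  rw [missProb_mul_sum hW.ne' a G hK]
  exact sum_le_sum fun p hp => mul_le_mul_of_nonneg_left (hF p hp) (hw p).le

theorem le_missProb_of_le_missProbAfter {w : Fin (n + 1) → ℝ} (hw : ∀ i, 0 < w i)
    {a : Fin (n + 1) → ℕ} {G : Finset (Fin (n + 1))} {K : ℤ} (hK : 0 ≤ K)
    {B : ℝ} {F : Fin (n + 1) → ℝ} (hF : ∀ p ∈ Gᶜ, F p ≤ missProbAfter p w a G K)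
    (hB : B * (∑ p ∈ G, w p + ∑ p ∈ Gᶜ, w p) ≤ ∑ p ∈ Gᶜ, w p * F p) :
    B ≤ missProb w a G K := by
  have hW : 0 < ∑ i, w i := sum_pos (fun i _ => hw i) univ_nonempty
  rw [sum_add_sum_compl] at hB
  refine le_of_mul_le_mul_right (hB.trans ?_) hW
  rw [missProb_mul_sum hW.ne' a G hK]
  exact sum_le_sum fun p hp => mul_le_mul_of_nonneg_left (hF p hp) (hw p).le

theorem missProb_le_exp {w : Fin n → ℝ} (hw : ∀ i, 0 < w i) {a : Fin n → ℕ}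
    {G : Finset (Fin n)} (hG : G.Nonempty) {θ : ℝ} (hθ : 0 ≤ θ)
    (hwG : ∑ i ∈ Gᶜ, w i * (Real.exp (θ * a i) - 1) ≤ ∑ i ∈ G, w i) (K : ℤ) :
    missProb w a G K ≤ Real.exp (-(θ * (K + 1))) := by
  induction n generalizing K with
  | zero => exact hG.choose.elim0
  | succ n ih =>
    rcases lt_or_ge K 0 with hK | hK
    · rw [missProb_of_neg hw a G hK, Real.one_le_exp_iff, neg_nonneg]
      exact mul_nonpos_of_nonneg_of_nonpos hθ (by exact_mod_cast hK)
    set E := Real.exp (-(θ * (K + 1))) with hE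
    have hafter (p) (hp : p ∈ Gᶜ) : missProbAfter p w a G K ≤ E * Real.exp (θ * a p) := by
      have hpG : p ∉ G := mem_compl.1 hp
      refine (ih (fun j => hw _) ?_ ?_ _).trans_eq ?_
      · rwa [← map_nonempty, map_relabel_survivors, erase_eq_of_notMem hpG]
      · rw [compl_survivors, sum_survivors p G w, erase_eq_of_notMem hpG,
          sum_survivors p Gᶜ fun i => w i * (Real.exp (θ * a i) - 1)]
        refine (sum_le_sum_of_subset_of_nonneg (erase_subset _ _) fun i _ _ => ?_).trans hwG
        exact mul_nonneg (hw i).le (sub_nonneg.2 (Real.one_le_exp (by positivity)))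
      · rw [hE, ← Real.exp_add]
        push_cast
        ring_nf
    refine missProb_le_of_missProbAfter_le hw hK hafter ?_
    calc ∑ p ∈ Gᶜ, w p * (E * Real.exp (θ * a p))
        = E * (∑ p ∈ Gᶜ, w p * (Real.exp (θ * a p) - 1) + ∑ p ∈ Gᶜ, w p) := by
          rw [← sum_add_distrib, mul_sum]
          exact sum_congr rfl fun p _ => by ring
      _ ≤ E * (∑ p ∈ G, w p + ∑ p ∈ Gᶜ, w p) := by gcongr

/-- The submartingale inequality for `c / y`, where `y = c + K + m` drops by `a i` when `i ∈ T` is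
drawn and the process stops at `0` when a member of `S` is drawn. -/
theorem div_mul_sum_one_div_le {ι : Type*} {S T : Finset ι} {a : ι → ℝ} {c y : ℝ} (hc : 0 ≤ c)
    (hy : 1 < y) (ha : ∀ i ∈ T, 1 ≤ a i) (hay : ∀ i ∈ T, a i < y)
    (hS : ∑ i ∈ S, 1 / a i ≤ 1) (hT : y - 1 ≤ #T) :
    c / y * (∑ i ∈ S, 1 / a i + ∑ i ∈ T, 1 / a i) ≤ ∑ i ∈ T, 1 / a i * (c / (y - a i)) := by
  have : 0 < y := one_pos.trans hy
  have hgain (i) (hi : i ∈ T) :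
      c / y * (1 / (y - 1)) + c / y * (1 / a i) ≤ 1 / a i * (c / (y - a i)) := by
    have hai : a i ≠ 0 := (one_pos.trans_le (ha i hi)).ne'
    have hyai : 0 < y - a i := sub_pos.2 (hay i hi)
    calc c / y * (1 / (y - 1)) + c / y * (1 / a i)
        ≤ c / y * (1 / (y - a i)) + c / y * (1 / a i) := by
          gcongr
          exact ha i hi
      _ = 1 / a i * (c / (y - a i)) := by
          have := hyai.ne'
          field_simp
          ring
  have hSone : ∑ i ∈ S, 1 / a i ≤ #T * (1 / (y - 1)) := by
    rw [mul_one_div]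
    exact hS.trans ((one_le_div (sub_pos.2 hy)).2 hT)
  calc c / y * (∑ i ∈ S, 1 / a i + ∑ i ∈ T, 1 / a i)
      ≤ c / y * (#T * (1 / (y - 1)) + ∑ i ∈ T, 1 / a i) := by gcongr
    _ = ∑ i ∈ T, (c / y * (1 / (y - 1)) + c / y * (1 / a i)) := by
        rw [sum_add_distrib, sum_const, nsmul_eq_mul, mul_add, mul_sum]
        ring
    _ ≤ ∑ i ∈ T, 1 / a i * (c / (y - a i)) := sum_le_sum hgain

theorem div_le_missProb {a : Fin n → ℕ} (ha : ∀ i, 1 ≤ a i) {m : ℕ} (ham : ∀ i, a i ≤ m)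
    {G : Finset (Fin n)} (hG : ∑ i ∈ G, 1 / (a i : ℝ) ≤ 1) {c : ℝ} (hc : 0 < c) {K : ℤ}
    (hK : 0 ≤ K + m) (hcard : c + (K + m) ≤ #Gᶜ + 1) :
    c / (c + (K + m)) ≤ missProb (fun i => 1 / (a i : ℝ)) a G K := by
  have hw (i) : 0 < 1 / (a i : ℝ) := Nat.one_div_cast_pos (Nat.one_le_iff_ne_zero.1 (ha i))
  have hle_one {K : ℤ} (hK : 0 ≤ K + m) : c / (c + (K + m)) ≤ 1 := by
    have : (0 : ℝ) ≤ K + m := by exact_mod_cast hK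
    exact div_le_one_of_le₀ (by linarith) (by linarith)
  induction n generalizing K with
  | zero => exact (hle_one hK).trans_eq (missProb_eq_one hw fun _ t => t.elim0).symm
  | succ n ih =>
    rcases lt_or_ge K 0 with hK' | hK'
    · exact (hle_one hK).trans_eq (missProb_of_neg hw a G hK').symm
    have ha' (i) : (1 : ℝ) ≤ a i := by exact_mod_cast ha i
    have hay (i) : a i < c + (K + m) := by
      have : (0 : ℝ) ≤ K := by exact_mod_cast hK'
      have : (a i : ℝ) ≤ m := by exact_mod_cast ham i
      linarith
    have hafter (p) (hp : p ∈ Gᶜ) :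
        c / (c + (K + m) - a p) ≤ missProbAfter p (fun i => 1 / (a i : ℝ)) a G K := by
      have hden : c + (K + m) - a p = c + ((K - a p : ℤ) + m) := by
        push_cast
        ring
      have hcard_after : (#(survivors p G)ᶜ : ℝ) + 1 = #Gᶜ := by
        rw [compl_survivors, ← card_map (relabel p), map_relabel_survivors]
        exact_mod_cast card_erase_add_one hp
      have hKp : 0 ≤ K - a p + m := by
        have := ham p
        omega
      rw [hden]
      refine ih (fun j => ha _) (fun j => ham _) ?_ hKp ?_ (fun j => hw _)
      · rwa [sum_survivors p G fun i => 1 / (a i : ℝ), erase_eq_of_notMem (mem_compl.1 hp)]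
      · linarith [ha' p]
    exact le_missProb_of_le_missProbAfter hw hK' hafter
      (div_mul_sum_one_div_le hc.le ((ha' 0).trans_lt (hay 0)) (fun i _ => ha' i)
        (fun i _ => hay i) hG (by linarith))

end MissProb

/-! ### Expected utilities under group requests -/

section Serving

variable {n k : ℕ}

theorem add_sum_before_le (f : Fin n → ℕ) {σ : Equiv.Perm (Fin n)} {i j : Fin n}
    (hij : σ.symm i < σ.symm j) :
    f i + ∑ l ∈ before σ (σ.symm i), f l ≤ ∑ l ∈ before σ (σ.symm j), f l := by
  have hi : i ∉ before σ (σ.symm i) := fun h => (mem_before.1 h).false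
  rw [← sum_insert hi]
  exact sum_le_sum_of_subset (insert_subset (mem_before.2 hij) fun l hl =>
    mem_before.2 ((mem_before.1 hl).trans hij))

theorem sum_ticketsOf_lt_card_iff_misses {a : Fin n → Request k} {G : Finset (Fin n)}
    (hG : G.Nonempty) (haG : ∀ j ∈ G, (a j : ℕ) = #G) (σ : Equiv.Perm (Fin n)) :
    ∑ j ∈ G, ticketsOf a σ j < #G ↔ Misses (fun i => (a i : ℕ)) G (k - #G) σ := by
  constructor
  · intro hlt t ht
    have htickets := (single_le_sum (fun _ _ => Nat.zero_le _) ht).trans_lt hlt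
    rw [ticketsOf, haG _ ht, Equiv.symm_apply_apply] at htickets
    beta_reduce
    omega
  · intro hmiss
    obtain ⟨first, hfirst, hmin⟩ := G.exists_min_image σ.symm hG
    have hbefore : k < #G + ∑ j ∈ before σ (σ.symm first), (a j : ℕ) := by
      have hfirst_miss := hmiss (σ.symm first) (by rwa [Equiv.apply_symm_apply])
      beta_reduce at hfirst_miss
      omega
    have hlater (j) (hj : j ∈ G) (hne : j ≠ first) : ticketsOf a σ j = 0 := by
      have hle := add_sum_before_le (fun i => (a i : ℕ))
        ((hmin j hj).lt_of_ne (σ.symm.injective.ne hne.symm))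
      rw [haG first hfirst] at hle
      rw [ticketsOf, Nat.sub_eq_zero_of_le (hbefore.le.trans hle), Nat.min_zero]
    rw [sum_eq_single_of_mem first hfirst hlater, ticketsOf]
    have := hG.card_pos
    omega

end Serving

theorem one_div_mul_exp_div_sub_one_le {b d : ℝ} (hb : 0 < b) (hbd : b < d) :
    1 / b * (Real.exp (b / d) - 1) ≤ 1 / (d - b) := by
  have hd : 0 < d := hb.trans hbd
  have hsub : d - b ≠ 0 := (sub_pos.2 hbd).ne'
  calc 1 / b * (Real.exp (b / d) - 1) ≤ 1 / b * (1 / (1 - b / d) - 1) := by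
        gcongr
        exact Real.exp_bound_div_one_sub_of_interval (by positivity) ((div_lt_one hd).2 hbd)
    _ = 1 / (d - b) := by
        rw [one_sub_div hd.ne']
        field_simp
        ring

theorem sum_one_div_mul_exp_sub_one_le_one {ι : Type*} {T : Finset ι} {b : ι → ℝ} {m : ℝ}
    (hb : ∀ i ∈ T, 0 < b i) (hbm : ∀ i ∈ T, b i ≤ m) :
    ∑ i ∈ T, 1 / b i * (Real.exp (b i / (#T + m)) - 1) ≤ 1 := by
  have hterm (i) (hi : i ∈ T) : 1 / b i * (Real.exp (b i / (#T + m)) - 1) ≤ 1 / #T := by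
    have hT : (0 : ℝ) < #T := Nat.cast_pos.2 (card_pos.2 ⟨i, hi⟩)
    calc 1 / b i * (Real.exp (b i / (#T + m)) - 1) ≤ 1 / (#T + m - b i) :=
          one_div_mul_exp_div_sub_one_le (hb i hi) (by linarith [hbm i hi])
      _ ≤ 1 / #T := one_div_le_one_div_of_le hT (by linarith [hbm i hi])
  calc ∑ i ∈ T, 1 / b i * (Real.exp (b i / (#T + m)) - 1) ≤ #T • (1 / (#T : ℝ)) :=
        sum_le_card_nsmul _ _ _ hterm
    _ ≤ 1 := by
        rw [nsmul_eq_mul, mul_one_div]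
        exact div_self_le_one _

theorem mul_g_le_one_sub_exp {x α : ℝ} (hx : 0 ≤ x) (hα : 0 < α) (hxα : x ≤ α) :
    x * g α ≤ 1 - Real.exp (-x) := by
  have hchord := convexOn_exp.2 (Set.mem_univ (-α)) (Set.mem_univ 0) (div_nonneg hx hα.le)
    (sub_nonneg.2 ((div_le_one hα).2 hxα)) (add_sub_cancel _ _)
  have hpoint : x / α * -α = -x := by field_simp
  simp only [smul_eq_mul, mul_zero, add_zero, Real.exp_zero, mul_one, hpoint] at hchord
  calc x * g α = x / α - x / α * Real.exp (-α) := by rw [g]; ring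
    _ ≤ 1 - Real.exp (-x) := by linarith

theorem g_pos {α : ℝ} (hα : 0 < α) : 0 < g α :=
  div_pos (sub_pos.2 (Real.exp_lt_one_iff.2 (neg_lt_zero.2 hα))) hα

namespace LotteryInstance

variable (I : LotteryInstance)

theorem expectedUtility_weightedIndividualLottery (a : Fin I.n → Request I.k) (i : Fin I.n) :
    I.expectedUtility i (weightedIndividualLottery a) =
      ∑ σ, orderProb a σ * I.utility i (allocate a σ) := by
  simp only [expectedUtility, weightedIndividualLottery, sum_mul]
  rw [sum_comm]
  simp only [ite_mul, zero_mul, sum_ite_eq', mem_univ, if_true]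

theorem mem_group (i : Fin I.n) : i ∈ I.group i := I.groups.mem_part (mem_univ i)

theorem group_eq_of_mem {i j : Fin I.n} (h : j ∈ I.group i) : I.group j = I.group i :=
  I.groups.part_eq_of_mem (I.groups.part_mem.2 (mem_univ i)) h

theorem one_le_card_group (i : Fin I.n) : 1 ≤ #(I.group i) := card_pos.2 ⟨i, I.mem_group i⟩

theorem card_group_le (i : Fin I.n) : #(I.group i) ≤ I.maxGroupSize :=
  le_sup (f := card) (I.groups.part_mem.2 (mem_univ i))

theorem card_compl_group (i : Fin I.n) : (#(I.group i)ᶜ : ℝ) = I.n - #(I.group i) := by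
  rw [card_compl, Fintype.card_fin, Nat.cast_sub (card_finset_fin_le _)]

theorem sum_one_div_card_group (i : Fin I.n) :
    ∑ j ∈ I.group i, 1 / (#(I.group j) : ℝ) = 1 := by
  have hcard : (#(I.group i) : ℝ) ≠ 0 :=
    Nat.cast_ne_zero.2 (Nat.one_le_iff_ne_zero.1 (I.one_le_card_group i))
  rw [sum_congr rfl fun j hj => by rw [I.group_eq_of_mem hj], sum_const, nsmul_eq_mul,
    mul_one_div_cancel hcard]

variable {I}

theorem expectedUtility_groupRequest (h : I.maxGroupSize ≤ I.k) (i : Fin I.n) :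
    I.expectedUtility i (weightedIndividualLottery (I.groupRequest h)) =
      1 - missProb (fun j => 1 / (#(I.group j) : ℝ)) (fun j => #(I.group j)) (I.group i)
        (I.k - #(I.group i)) := by
  have hw (j) : 0 < 1 / (#(I.group j) : ℝ) :=
    one_div_pos.2 (Nat.cast_pos.2 (I.one_le_card_group j))
  rw [expectedUtility_weightedIndividualLottery, eq_sub_iff_add_eq, missProb, sum_filter,
    ← sum_add_distrib]
  refine (sum_congr rfl fun σ _ => ?_).trans (sum_drawProb I.n _ hw)
  have hmiss := sum_ticketsOf_lt_card_iff_misses (a := I.groupRequest h) ⟨i, I.mem_group i⟩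
    (fun j hj => congrArg card (I.group_eq_of_mem hj)) σ
  have hutility : I.utility i (allocate (I.groupRequest h) σ) =
      if Misses (fun j => #(I.group j)) (I.group i) (I.k - #(I.group i)) σ then 0 else 1 := by
    rw [← ite_not]
    exact if_congr (not_lt.symm.trans hmiss.not) rfl rfl
  have horder : orderProb (I.groupRequest h) σ =
      drawProb (fun j => 1 / (#(I.group j) : ℝ)) σ := rfl
  rw [hutility, horder]
  split_ifs <;> ring

theorem one_sub_exp_card_group_le_expectedUtility (h : I.maxGroupSize ≤ I.k) (i : Fin I.n) :
    1 - Real.exp (-((I.k - #(I.group i) + 1) / (I.n - #(I.group i) + I.maxGroupSize))) ≤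
      I.expectedUtility i (weightedIndividualLottery (I.groupRequest h)) := by
  have hcard (j) : (1 : ℝ) ≤ #(I.group j) := by exact_mod_cast I.one_le_card_group j
  have hmax (j) : (#(I.group j) : ℝ) ≤ I.maxGroupSize := by exact_mod_cast I.card_group_le j
  rw [← card_compl_group, expectedUtility_groupRequest]
  set d : ℝ := #(I.group i)ᶜ + I.maxGroupSize
  have hd : 0 < d := add_pos_of_nonneg_of_pos (by positivity) (by linarith [hcard i, hmax i])
  have hexp : ∑ j ∈ (I.group i)ᶜ, 1 / (#(I.group j) : ℝ) * (Real.exp (1 / d * #(I.group j)) - 1) ≤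
      ∑ j ∈ I.group i, 1 / (#(I.group j) : ℝ) := by
    simp only [one_div_mul_eq_div d, sum_one_div_card_group]
    exact sum_one_div_mul_exp_sub_one_le_one (fun j _ => one_pos.trans_le (hcard j))
      fun j _ => hmax j
  have hmiss := missProb_le_exp (fun j => one_div_pos.2 (one_pos.trans_le (hcard j)))
    ⟨i, I.mem_group i⟩ (one_div_pos.2 hd).le hexp (I.k - #(I.group i))
  refine sub_le_sub_left (hmiss.trans_eq ?_) 1
  push_cast
  rw [one_div_mul_eq_div]

theorem one_sub_exp_maxGroupSize_le_expectedUtility (h : I.maxGroupSize ≤ I.k) (hkn : I.k ≤ I.n)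
    (i : Fin I.n) :
    1 - Real.exp (-((I.k - I.maxGroupSize + 1) / I.n)) ≤
      I.expectedUtility i (weightedIndividualLottery (I.groupRequest h)) := by
  refine le_trans ?_ (one_sub_exp_card_group_le_expectedUtility h i)
  have hcard : (1 : ℝ) ≤ #(I.group i) := by exact_mod_cast I.one_le_card_group i
  have hmax : (#(I.group i) : ℝ) ≤ I.maxGroupSize := by exact_mod_cast I.card_group_le i
  have hmk : (I.maxGroupSize : ℝ) ≤ I.k := by exact_mod_cast h
  have hkn : (I.k : ℝ) ≤ I.n := by exact_mod_cast hkn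
  gcongr 1 - Real.exp (-?_)
  rw [div_le_div_iff₀ (by linarith) (by linarith)]
  nlinarith [mul_nonneg (sub_nonneg.2 hmax)
    (by linarith : (0 : ℝ) ≤ I.n - (I.k - I.maxGroupSize + 1))]

theorem expectedUtility_le_div (h : I.maxGroupSize ≤ I.k) (i : Fin I.n) :
    I.expectedUtility i (weightedIndividualLottery (I.groupRequest h)) ≤
      (I.k + I.maxGroupSize - 1) / I.n := by
  have hcard (j) : (1 : ℝ) ≤ #(I.group j) := by exact_mod_cast I.one_le_card_group j
  have hmax : (#(I.group i) : ℝ) ≤ I.maxGroupSize := by exact_mod_cast I.card_group_le i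
  have hmk : (I.maxGroupSize : ℝ) ≤ I.k := by exact_mod_cast h
  have hn : (0 : ℝ) < I.n := by exact_mod_cast I.n_pos
  rw [expectedUtility_groupRequest]
  set c : ℝ := I.n + 1 - I.k - I.maxGroupSize with hc
  rcases le_or_gt c 0 with hc0 | hc0
  · refine (sub_le_self _ (missProb_nonneg (fun j => by positivity) _ _ _)).trans ?_
    rw [one_le_div hn]
    linarith
  have hmiss := div_le_missProb I.one_le_card_group I.card_group_le
    (I.sum_one_div_card_group i).le hc0 (K := I.k - #(I.group i))
    (by have := I.card_group_le i; omega)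
    (by rw [card_compl_group]; push_cast; linarith)
  have hden : c + (((I.k - #(I.group i) : ℤ) : ℝ) + I.maxGroupSize) = I.n - #(I.group i) + 1 := by
    push_cast
    ring
  rw [hden] at hmiss
  calc _ ≤ 1 - c / (I.n - #(I.group i) + 1) := sub_le_sub_left hmiss 1
    _ ≤ 1 - c / I.n := by
        gcongr
        · linarith
        · linarith [hcard i]
    _ = (I.k + I.maxGroupSize - 1) / I.n := by
        rw [one_sub_div hn.ne', hc]
        ring

theorem isEfficient_of_le_expectedUtility {β : ℝ} {π : LotteryAllocation I.n I.k}
    (hβ : ∀ i, β * (I.k / I.n) ≤ I.expectedUtility i π) : I.IsEfficient β π := by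
  have hk : (I.k : ℝ) ≠ 0 := by exact_mod_cast I.k_pos.ne'
  have hn : (I.n : ℝ) ≠ 0 := by exact_mod_cast I.n_pos.ne'
  calc β = 1 / I.k * ∑ _i : Fin I.n, β * (I.k / I.n) := by
        rw [sum_const, card_univ, Fintype.card_fin, nsmul_eq_mul]
        field_simp
    _ ≤ I.utilization π := by
        rw [utilization]
        gcongr with i
        exact hβ i

theorem isFair_of_expectedUtility_mem_Icc {β lo hi : ℝ} {π : LotteryAllocation I.n I.k}
    (hlo : 0 ≤ lo) (hmem : ∀ i, I.expectedUtility i π ∈ Set.Icc lo hi) (hβ : β * hi ≤ lo) :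
    I.IsFair β π := by
  intro i i'
  rcases le_or_gt β 0 with hβ0 | hβ0
  · exact (mul_nonpos_of_nonpos_of_nonneg hβ0 (hlo.trans (hmem i').1)).trans
      (hlo.trans (hmem i).1)
  · exact (mul_le_mul_of_nonneg_left (hmem i').2 hβ0.le).trans (hβ.trans (hmem i).1)

variable {κ α : ℝ}

theorem maxGroupSize_sub_one_le (hI : I ∈ instanceFamily κ α) :
    (I.maxGroupSize : ℝ) - 1 ≤ κ * I.k :=
  (div_le_iff₀ (Nat.cast_pos.2 I.k_pos)).1 hI.1

theorem le_expectedUtility_of_mem_instanceFamily (hκ : κ ∈ Set.Icc (0 : ℝ) 1)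
    (hα : α ∈ Set.Ioc (0 : ℝ) 1) (hI : I ∈ instanceFamily κ α) (h : I.maxGroupSize ≤ I.k)
    (i : Fin I.n) :
    (1 - κ) * g α * (I.k / I.n) ≤
      I.expectedUtility i (weightedIndividualLottery (I.groupRequest h)) := by
  have hn : (0 : ℝ) < I.n := by exact_mod_cast I.n_pos
  have hkn : I.k ≤ I.n := by exact_mod_cast (div_le_one hn).1 (hI.2.trans hα.2)
  have hx0 : 0 ≤ (1 - κ) * (I.k / I.n : ℝ) := mul_nonneg (sub_nonneg.2 hκ.2) (by positivity)
  have hxα : (1 - κ) * (I.k / I.n : ℝ) ≤ α :=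
    (mul_le_of_le_one_left (by positivity) (sub_le_self _ hκ.1)).trans hI.2
  calc (1 - κ) * g α * (I.k / I.n) = (1 - κ) * (I.k / I.n) * g α := by ring
    _ ≤ 1 - Real.exp (-((1 - κ) * (I.k / I.n))) := mul_g_le_one_sub_exp hx0 hα.1 hxα
    _ ≤ 1 - Real.exp (-((I.k - I.maxGroupSize + 1) / I.n)) := by
        rw [← mul_div_assoc]
        gcongr
        linarith [maxGroupSize_sub_one_le hI]
    _ ≤ _ := one_sub_exp_maxGroupSize_le_expectedUtility h hkn i

theorem expectedUtility_le_of_mem_instanceFamily (hI : I ∈ instanceFamily κ α)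
    (h : I.maxGroupSize ≤ I.k) (i : Fin I.n) :
    I.expectedUtility i (weightedIndividualLottery (I.groupRequest h)) ≤
      (1 + κ) * (I.k / I.n) := by
  refine (expectedUtility_le_div h i).trans ?_
  rw [← mul_div_assoc]
  gcongr
  linarith [maxGroupSize_sub_one_le hI]

end LotteryInstance

end TicketLottery

theorem mainTheorem2 (κ α : ℝ) (hκ : κ ∈ Set.Ioo (0 : ℝ) 1) (hα : α ∈ Set.Ioo (0 : ℝ) 1)
    (I : TicketLottery.LotteryInstance) (hI : I ∈ TicketLottery.instanceFamily κ α) :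
    I.IsEfficient ((1 - κ) * TicketLottery.g α)
        (TicketLottery.weightedIndividualLottery
          (I.groupRequest (TicketLottery.maxGroupSize_le hκ.2 hI))) ∧
      I.IsFair ((1 - 2 * κ) * TicketLottery.g α)
        (TicketLottery.weightedIndividualLottery
          (I.groupRequest (TicketLottery.maxGroupSize_le hκ.2 hI))) := by
  have lower := TicketLottery.LotteryInstance.le_expectedUtility_of_mem_instanceFamily
    (Set.Ioo_subset_Icc_self hκ) (Set.Ioo_subset_Ioc_self hα) hI
    (TicketLottery.maxGroupSize_le hκ.2 hI)
  have upper := TicketLottery.LotteryInstance.expectedUtility_le_of_mem_instanceFamily hI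
    (TicketLottery.maxGroupSize_le hκ.2 hI)
  have hg : 0 < TicketLottery.g α := TicketLottery.g_pos hα.1
  have hq : 0 ≤ (I.k : ℝ) / I.n := by positivity
  refine ⟨TicketLottery.LotteryInstance.isEfficient_of_le_expectedUtility lower,
    TicketLottery.LotteryInstance.isFair_of_expectedUtility_mem_Icc
      (mul_nonneg (mul_nonneg (sub_nonneg.2 hκ.2.le) hg.le) hq) (fun i => ⟨lower i, upper i⟩) ?_⟩
  calc (1 - 2 * κ) * TicketLottery.g α * ((1 + κ) * (I.k / I.n))
      = (1 - κ - 2 * κ ^ 2) * TicketLottery.g α * (I.k / I.n) := by ring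
    _ ≤ (1 - κ) * TicketLottery.g α * (I.k / I.n) := by
      refine mul_le_mul_of_nonneg_right (mul_le_mul_of_nonneg_right ?_ hg.le) hq
      exact sub_le_self _ (by positivity)
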